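/- Let $M\cong\mathbb{Z}^n$ and $N$ be dual lattices, and let $\Delta\subset M_{\mathbb R}$ be an $n$-dimensional lattice polytope. For a nonempty polytope $P\subset M_{\mathbb R}$ and $\nu\in N$ put $\mathrm{Min}_P(\nu)=\min_{x\in P}\langle x,\nu\rangle$, and let $$F(\Delta)=\{x\in M_{\mathbb R} : \langle x,\nu\rangle\ge \mathrm{Min}_\Delta(\nu)+1\ \ \forall\,\nu\in N\setminus\{0\}\}$$ be the Fine interior of $\Delta$. Assume $F(\Delta)\neq\emptyset$, and let $$S_F(\Delta)=\{\nu\in N\setminus\{0\} : \mathrm{Min}_{F(\Delta)}(\nu)=\mathrm{Min}_\Delta(\nu)+1\},\qquad C(\Delta)=\{x\in M_{\mathbb R} : \langle x,\nu\rangle\ge \mathrm{Min}_\Delta(\nu)\ \ \forall\,\nu\in S_F(\Delta)\}$$ be the support of the Fine interior and the canonical closure of $\Delta$. Let $\Sigma$ be a complete simplicial fan in $N_{\mathbb R}$ whose set of primitive ray generators is $\Sigma[1]=S_F(\Delta)$ and which refines the normal fans of $C(\Delta)$ and of $F(\Delta)$, i.e. for $P=C(\Delta)$ and for $P=F(\Delta)$,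 all elements of any given cone of $\Sigma$ attain their minimum over $P$ at a common point of $P$. (Equivalently, in terms of the hypersurface $Y$ defined next, $Y$ and $K_{\mathbb P}+Y$ are nef.) Let $\mathbb P$ be the complex toric variety of $\Sigma$. Let $f\in\mathbb C[M]$ be a Laurent polynomial with Newton polytope $\Delta$, let $Z_f=\{f=0\}$ be its zero scheme in the torus $T=\operatorname{Spec}\mathbb C[M]$, and let $Y\subset\mathbb P$ be the (scheme-theoretic) closure of $Z_f$ in $\mathbb P$. Then $Y\subset\mathbb P$ is a Cartier divisor (its ideal sheaf is locally generated by one nonzerodivisor) if and only if $C(\Delta)$ is a lattice polytope. -/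

import Mathlib

open CategoryTheory CategoryTheory.Limits AlgebraicGeometry

noncomputable section

namespace ToricHypersurface

variable {n : ℕ}

/-! ### Lattices and polytopes

The lattices `M` and `N` are `ℤⁿ`, dual to each other by the dot product;
`M_ℝ` and `N_ℝ` are `ℝⁿ`. -/

/-- The inclusion `ℤⁿ ⊂ ℝⁿ`. -/
def toReal (m : Fin n → ℤ) : Fin n → ℝ := fun i => (m i : ℝ)

/-- A lattice polytope: the convex hull of finitely many lattice points. -/
def IsLatticePolytope (P : Set (Fin n → ℝ)) : Prop :=
  ∃ s : Finset (Fin n → ℤ), P = convexHull ℝ (toReal '' (s : Set (Fin n → ℤ)))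

/-- `Min_P(ν)`, the minimum over `x ∈ P` of `⟨x, ν⟩`. It is only used for nonempty polytopes `P`,
where the infimum is attained. -/
def minOn (P : Set (Fin n → ℝ)) (ν : Fin n → ℤ) : ℝ :=
  sInf ((fun x => x ⬝ᵥ toReal ν) '' P)

/-- The Fine interior `F(Δ)`. -/
def fineInterior (Δ : Set (Fin n → ℝ)) : Set (Fin n → ℝ) :=
  {x | ∀ ν : Fin n → ℤ, ν ≠ 0 → minOn Δ ν + 1 ≤ x ⬝ᵥ toReal ν}

/-- The support `S_F(Δ)` of the Fine interior. -/
def fineSupport (Δ : Set (Fin n → ℝ)) : Set (Fin n → ℤ) :=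
  {ν | ν ≠ 0 ∧ minOn (fineInterior Δ) ν = minOn Δ ν + 1}

/-- The canonical closure `C(Δ)`. -/
def canonicalClosure (Δ : Set (Fin n → ℝ)) : Set (Fin n → ℝ) :=
  {x | ∀ ν ∈ fineSupport Δ, minOn Δ ν ≤ x ⬝ᵥ toReal ν}

/-! ### Fans -/

/-- A cone in `N_ℝ`. -/
abbrev Cone (n : ℕ) := PointedCone ℝ (Fin n → ℝ)

/-- `σ` is generated by finitely many lattice vectors. -/
def IsRationalPolyhedral (σ : Cone n) : Prop :=
  ∃ s : Finset (Fin n → ℤ), σ = PointedCone.hull ℝ (toReal '' (s : Set (Fin n → ℤ)))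

/-- `τ = σ ∩ m^⊥` for some `m ∈ σ^∨ ∩ M`. These are the faces of a rational polyhedral cone. -/
def IsFace (τ σ : Cone n) : Prop :=
  ∃ m : Fin n → ℤ, (∀ v ∈ σ, 0 ≤ toReal m ⬝ᵥ v) ∧ ∀ v, v ∈ τ ↔ v ∈ σ ∧ toReal m ⬝ᵥ v = 0

end ToricHypersurface

open ToricHypersurface in
/-- A fan in `N_ℝ = ℝⁿ`: a nonempty finite collection of rational strongly convex polyhedral
cones, closed under taking faces, and such that the intersection of two cones is a face of each.
(Since `{0}` is a face of every strongly convex cone, nonemptiness means that `{0}` is a cone.) -/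
structure ToricFan (n : ℕ) where
  cones : Set (Cone n)
  finite : cones.Finite
  bot_mem : ⊥ ∈ cones
  rational : ∀ σ ∈ cones, IsRationalPolyhedral σ
  stronglyConvex : ∀ σ ∈ cones, ∀ v ∈ σ, -v ∈ σ → v = 0
  face_mem : ∀ σ ∈ cones, ∀ τ, IsFace τ σ → τ ∈ cones
  inter_isFace : ∀ σ ∈ cones, ∀ τ ∈ cones, IsFace (σ ⊓ τ) σ

namespace ToricFan

open ToricHypersurface

variable {n : ℕ} (S : ToricFan n)

/-- The cones cover `N_ℝ`. -/
def IsComplete : Prop := ∀ v : Fin n → ℝ, ∃ σ ∈ S.cones, v ∈ σ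

/-- Every cone is generated by linearly independent vectors. -/
def IsSimplicial : Prop := ∀ σ ∈ S.cones, PointedCone.IsSimplicial σ

/-- The set `Σ[1]`: the primitive lattice vectors that generate a ray of the fan. -/
def rayGenerators : Set (Fin n → ℤ) :=
  {ν | (∀ (k : ℤ) (w : Fin n → ℤ), ν = k • w → IsUnit k) ∧
    PointedCone.hull ℝ {toReal ν} ∈ S.cones}

/-- Every cone of the fan lies in a cone of the (possibly degenerate) normal fan of the polytope
`P`, that is, all the linear forms in the cone attain their minimum over `P` at a common point. -/
def RefinesNormalFan (P : Set (Fin n → ℝ)) : Prop :=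
  ∀ σ ∈ S.cones, ∃ x ∈ P, ∀ v ∈ σ, ∀ y ∈ P, x ⬝ᵥ v ≤ y ⬝ᵥ v

/-- The fans of the toric varieties in which the closure of a hypersurface with Newton polytope `Δ`
is a minimal model: complete simplicial fans with rays `S_F(Δ)` that refine the normal fans of
`C(Δ)` (the closure `Y` is nef) and of `F(Δ)` (the adjoint divisor `K + Y` is nef). Terminality of
the toric variety is not listed, since it follows: a lattice vector in a cone whose coefficients in
terms of the ray generators have sum at most `1` lies in `S_F(Δ)` or is `0`. -/
structure IsMinimalFor (Δ : Set (Fin n → ℝ)) : Prop where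
  complete : S.IsComplete
  simplicial : S.IsSimplicial
  rays : S.rayGenerators = fineSupport Δ
  refines_canonicalClosure : S.RefinesNormalFan (canonicalClosure Δ)
  refines_fineInterior : S.RefinesNormalFan (fineInterior Δ)

end ToricFan

namespace ToricHypersurface

variable {n : ℕ}

/-! ### Affine toric varieties -/

/-- The monoid `σ^∨ ∩ M`. -/
def dualMonoid (σ : Cone n) : AddSubmonoid (Fin n → ℤ) where
  carrier := {m | ∀ v ∈ σ, 0 ≤ toReal m ⬝ᵥ v}
  zero_mem' := by
    intro v _
    have : toReal (0 : Fin n → ℤ) = 0 := by ext; simp [toReal]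
    simp [this]
  add_mem' := by
    intro a b ha hb v hv
    have : toReal (a + b) = toReal a + toReal b := by ext; simp [toReal]
    rw [this, add_dotProduct]
    exact add_nonneg (ha v hv) (hb v hv)

/-- The coordinate ring `ℂ[σ^∨ ∩ M]` of the affine toric variety `U_σ`. -/
abbrev chartRing (σ : Cone n) : Type := AddMonoidAlgebra ℂ (dualMonoid σ)

/-- The ring of Laurent polynomials `ℂ[M]`. -/
abbrev Laurent (n : ℕ) : Type := AddMonoidAlgebra ℂ (Fin n → ℤ)

lemma dualMonoid_anti {τ σ : Cone n} (h : τ ≤ σ) : dualMonoid σ ≤ dualMonoid τ :=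
  fun _ hm v hv => hm v (h hv)

/-- The inclusion `ℂ[σ^∨ ∩ M] ⊂ ℂ[τ^∨ ∩ M]` for `τ ⊂ σ`. -/
def chartRingMap {τ σ : Cone n} (h : τ ≤ σ) : chartRing σ →+* chartRing τ :=
  AddMonoidAlgebra.mapDomainRingHom ℂ (AddSubmonoid.inclusion (dualMonoid_anti h))

/-- The inclusion `ℂ[σ^∨ ∩ M] ⊂ ℂ[M]`. -/
def chartRingToLaurent (σ : Cone n) : chartRing σ →+* Laurent n :=
  AddMonoidAlgebra.mapDomainRingHom ℂ (dualMonoid σ).subtype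

lemma exists_nsmul_add_mem_dualMonoid {τ σ : Cone n} (hσ : IsRationalPolyhedral σ)
    (m : dualMonoid σ) (hm : ∀ v, v ∈ τ ↔ v ∈ σ ∧ toReal (m : Fin n → ℤ) ⬝ᵥ v = 0)
    (w : dualMonoid τ) : ∃ k₀ : ℕ, ∀ k ≥ k₀, (w : Fin n → ℤ) + k • (m : Fin n → ℤ) ∈ dualMonoid σ := by
  obtain ⟨s, rfl⟩ := hσ
  have hcast : ∀ (k : ℕ) (v : Fin n → ℝ), toReal ((w : Fin n → ℤ) + k • (m : Fin n → ℤ)) ⬝ᵥ v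
      = toReal (w : Fin n → ℤ) ⬝ᵥ v + k * (toReal (m : Fin n → ℤ) ⬝ᵥ v) := by
    intro k v
    have : toReal ((w : Fin n → ℤ) + k • (m : Fin n → ℤ))
        = toReal (w : Fin n → ℤ) + (k : ℝ) • toReal (m : Fin n → ℤ) := by
      ext; simp [toReal]
    rw [this, add_dotProduct, smul_dotProduct, smul_eq_mul]
  have key : ∀ a ∈ s, ∃ k₀ : ℕ, ∀ k ≥ k₀,
      0 ≤ toReal ((w : Fin n → ℤ) + k • (m : Fin n → ℤ)) ⬝ᵥ toReal a := by
    intro a ha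
    have has : toReal a ∈ PointedCone.hull ℝ (toReal '' (s : Set (Fin n → ℤ))) :=
      PointedCone.subset_hull ⟨a, ha, rfl⟩
    have h0 := m.2 _ has
    rcases h0.eq_or_lt with h0 | h0
    · refine ⟨0, fun k _ => ?_⟩
      rw [hcast, ← h0, mul_zero, add_zero]
      exact w.2 _ ((hm _).2 ⟨has, h0.symm⟩)
    · obtain ⟨k₀, hk₀⟩ := Archimedean.arch (-(toReal (w : Fin n → ℤ) ⬝ᵥ toReal a)) h0
      refine ⟨k₀, fun k hk => ?_⟩
      rw [hcast]
      rw [nsmul_eq_mul] at hk₀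
      have : (k₀ : ℝ) ≤ k := by exact_mod_cast hk
      nlinarith
  choose! K hK using key
  refine ⟨s.sup K, fun k hk v hv => ?_⟩
  induction hv using Submodule.span_induction with
  | mem x hx =>
    obtain ⟨a, ha, rfl⟩ := hx
    exact hK a ha k ((Finset.le_sup ha).trans hk)
  | zero => simp
  | add x y _ _ hx hy => rw [dotProduct_add]; exact add_nonneg hx hy
  | smul c x _ hx =>
    have : c • x = (c : ℝ) • x := rfl
    rw [this, dotProduct_smul, smul_eq_mul]
    exact mul_nonneg c.2 hx

lemma chartRingMap_single {τ σ : Cone n} (h : τ ≤ σ) (a : dualMonoid σ) (c : ℂ) :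
    chartRingMap h (AddMonoidAlgebra.single a c) =
      AddMonoidAlgebra.single ⟨a.1, dualMonoid_anti h a.2⟩ c := by
  simp [chartRingMap]
  rfl

/-- For a face `τ = σ ∩ m^⊥`, the ring `ℂ[τ^∨ ∩ M]` is the localization of `ℂ[σ^∨ ∩ M]` at
`x^m`. -/
lemma isLocalization_chartRingMap {τ σ : Cone n} (hσ : IsRationalPolyhedral σ) (h : τ ≤ σ)
    (m : dualMonoid σ) (hm : ∀ v, v ∈ τ ↔ v ∈ σ ∧ toReal (m : Fin n → ℤ) ⬝ᵥ v = 0) :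
    letI := (chartRingMap h).toAlgebra
    IsLocalization.Away (AddMonoidAlgebra.single m (1 : ℂ) : chartRing σ) (chartRing τ) := by
  let := (chartRingMap h).toAlgebra
  have halg : ∀ x, algebraMap (chartRing σ) (chartRing τ) x = chartRingMap h x := fun _ => rfl
  have hneg : -(m : Fin n → ℤ) ∈ dualMonoid τ := by
    intro v hv
    have : toReal (-(m : Fin n → ℤ)) = -toReal (m : Fin n → ℤ) := by ext; simp [toReal]
    rw [this, neg_dotProduct, ((hm v).1 hv).2, neg_zero]
  have hpow : ∀ k : ℕ, chartRingMap h (AddMonoidAlgebra.single m (1 : ℂ) ^ k) =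
      AddMonoidAlgebra.single
        ⟨k • (m : Fin n → ℤ), nsmul_mem (dualMonoid_anti h m.2) k⟩ 1 := by
    intro k
    rw [AddMonoidAlgebra.single_pow, chartRingMap_single, one_pow]
    rfl
  refine (isLocalization_iff _ _).2 ⟨?_, ?_, ?_⟩
  · rintro ⟨_, k, rfl⟩
    rw [halg, map_pow]
    refine IsUnit.pow k ?_
    refine IsUnit.of_mul_eq_one (AddMonoidAlgebra.single ⟨_, hneg⟩ 1) ?_
    rw [chartRingMap_single, AddMonoidAlgebra.single_mul_single, AddMonoidAlgebra.one_def]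
    congr 1
    · ext; simp
    · simp
  · have main : ∀ z : chartRing τ, ∃ k₀ : ℕ, ∀ k ≥ k₀, ∃ x : chartRing σ,
        z * chartRingMap h (AddMonoidAlgebra.single m (1 : ℂ) ^ k) = chartRingMap h x := by
      intro z
      induction z using AddMonoidAlgebra.induction_linear with
      | zero => exact ⟨0, fun k _ => ⟨0, by simp⟩⟩
      | add x y hx hy =>
        obtain ⟨k₁, h₁⟩ := hx
        obtain ⟨k₂, h₂⟩ := hy
        refine ⟨max k₁ k₂, fun k hk => ?_⟩
        obtain ⟨x', hx'⟩ := h₁ k (le_of_max_le_left hk)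
        obtain ⟨y', hy'⟩ := h₂ k (le_of_max_le_right hk)
        exact ⟨x' + y', by rw [add_mul, hx', hy', map_add]⟩
      | single w c =>
        obtain ⟨k₀, hk₀⟩ := exists_nsmul_add_mem_dualMonoid hσ m hm w
        refine ⟨k₀, fun k hk => ⟨AddMonoidAlgebra.single ⟨_, hk₀ k hk⟩ c, ?_⟩⟩
        rw [hpow, AddMonoidAlgebra.single_mul_single, chartRingMap_single, mul_one]
        rfl
    intro z
    obtain ⟨k, hk⟩ := main z
    obtain ⟨x, hx⟩ := hk k le_rfl
    exact ⟨(x, ⟨_, k, rfl⟩), hx⟩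
  · intro x y hxy
    refine ⟨1, ?_⟩
    have : Function.Injective (chartRingMap h) :=
      AddMonoidAlgebra.mapDomain_injective (AddSubmonoid.inclusion_injective _)
    rw [this hxy]

end ToricHypersurface

namespace ToricFan

open ToricHypersurface

variable {n : ℕ} (S : ToricFan n)

/-- The diagram of the affine toric varieties `U_σ` and the maps `U_τ → U_σ` for `τ ⊂ σ`. -/
def chartDiagram : S.cones ⥤ Scheme.{0} where
  obj σ := Spec (CommRingCat.of (chartRing σ.1))
  map f := Spec.map (CommRingCat.ofHom (chartRingMap (leOfHom f)))
  map_id σ := by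
    have : chartRingMap (leOfHom (𝟙 σ)) = RingHom.id (chartRing σ.1) :=
      AddMonoidAlgebra.mapDomainRingHom_id
    rw [this]
    exact Spec.map_id _
  map_comp f g := by
    rw [← Spec.map_comp, ← CommRingCat.ofHom_comp]
    congr 2
    exact AddMonoidAlgebra.mapDomainRingHom_comp (R := ℂ)
      (AddSubmonoid.inclusion (dualMonoid_anti (leOfHom f)))
      (AddSubmonoid.inclusion (dualMonoid_anti (leOfHom g)))

lemma isFace_of_le {τ σ : Cone n} (hτ : τ ∈ S.cones) (hσ : σ ∈ S.cones) (h : τ ≤ σ) :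
    IsFace τ σ := by
  have := S.inter_isFace σ hσ τ hτ
  rwa [inf_eq_right.2 h] at this

/-- If `τ = σ ∩ m^⊥`, then `U_τ → U_σ` is the inclusion of the principal open subset where `x^m`
does not vanish. -/
lemma chartDiagram_map_spec {τ σ : S.cones} (f : τ ⟶ σ) (m : dualMonoid σ.1)
    (hm : ∀ v, v ∈ τ.1 ↔ v ∈ σ.1 ∧ toReal (m : Fin n → ℤ) ⬝ᵥ v = 0) :
    IsOpenImmersion (S.chartDiagram.map f) ∧
      Set.range (S.chartDiagram.map f) = (PrimeSpectrum.basicOpen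
        (AddMonoidAlgebra.single m (1 : ℂ) : chartRing σ.1) : Set (PrimeSpectrum _)) := by
  let := (chartRingMap (leOfHom f)).toAlgebra
  have := isLocalization_chartRingMap (S.rational _ σ.2) (leOfHom f) m hm
  constructor
  · exact IsOpenImmersion.of_isLocalization
      (AddMonoidAlgebra.single m (1 : ℂ) : chartRing σ.1)
  · exact PrimeSpectrum.localization_away_comap_range (chartRing τ.1)
      (AddMonoidAlgebra.single m (1 : ℂ) : chartRing σ.1)

instance {τ σ : S.cones} (f : τ ⟶ σ) : IsOpenImmersion (S.chartDiagram.map f) := by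
  obtain ⟨m, hm, hm'⟩ := S.isFace_of_le τ.2 σ.2 (leOfHom f)
  exact (S.chartDiagram_map_spec f ⟨m, hm⟩ hm').1

instance : (S.chartDiagram ⋙ Scheme.forget).IsLocallyDirected where
  cond := by
    intro i j k fi fj xi xj hx
    change S.chartDiagram.map fi xi = S.chartDiagram.map fj xj at hx
    obtain ⟨a, ha, ha'⟩ := S.isFace_of_le i.2 k.2 (leOfHom fi)
    obtain ⟨b, hb, hb'⟩ := S.isFace_of_le j.2 k.2 (leOfHom fj)
    let l : S.cones := ⟨i.1 ⊓ j.1, S.face_mem _ i.2 _ (S.inter_isFace _ i.2 _ j.2)⟩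
    let gi : l ⟶ i := homOfLE (show i.1 ⊓ j.1 ≤ i.1 from inf_le_left)
    let gj : l ⟶ j := homOfLE (show i.1 ⊓ j.1 ≤ j.1 from inf_le_right)
    let a' : dualMonoid k.1 := ⟨a, ha⟩
    let b' : dualMonoid k.1 := ⟨b, hb⟩
    have hab : ∀ v, v ∈ l.1 ↔ v ∈ k.1 ∧ toReal ((a' + b' : dualMonoid k.1) : Fin n → ℤ) ⬝ᵥ v = 0 := by
      intro v
      have e : toReal ((a' + b' : dualMonoid k.1) : Fin n → ℤ) = toReal a + toReal b := by
        ext; simp [toReal, a', b']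
      rw [e, add_dotProduct]
      change v ∈ i.1 ⊓ j.1 ↔ _
      rw [Submodule.mem_inf, ha' v, hb' v]
      constructor
      · rintro ⟨⟨h1, h2⟩, -, h3⟩
        exact ⟨h1, by rw [h2, h3, add_zero]⟩
      · rintro ⟨h1, h2⟩
        have := ha v h1
        have := hb v h1
        exact ⟨⟨h1, by linarith⟩, h1, by linarith⟩
    have hi := (S.chartDiagram_map_spec fi a' ha').2
    have hj := (S.chartDiagram_map_spec fj b' hb').2
    have hl := (S.chartDiagram_map_spec (gi ≫ fi) (a' + b') hab).2
    have mi : S.chartDiagram.map fi xi ∈ Set.range (S.chartDiagram.map fi) := ⟨_, rfl⟩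
    have mj : S.chartDiagram.map fi xi ∈ Set.range (S.chartDiagram.map fj) := ⟨xj, hx.symm⟩
    rw [hi] at mi
    rw [hj] at mj
    have ml : S.chartDiagram.map fi xi ∈ Set.range (S.chartDiagram.map (gi ≫ fi)) := by
      rw [hl]
      have : (AddMonoidAlgebra.single (a' + b') (1 : ℂ) : chartRing k.1) =
          AddMonoidAlgebra.single a' 1 * AddMonoidAlgebra.single b' 1 := by
        rw [AddMonoidAlgebra.single_mul_single, one_mul]
      rw [this, PrimeSpectrum.basicOpen_mul]
      exact ⟨mi, mj⟩
    obtain ⟨x, hxl⟩ := ml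
    refine ⟨l, gi, gj, x, ?_, ?_⟩
    · apply (S.chartDiagram.map fi).isOpenEmbedding.injective
      rw [← hxl, Functor.map_comp, Scheme.Hom.comp_apply]
      rfl
    · apply (S.chartDiagram.map fj).isOpenEmbedding.injective
      rw [← hx, ← hxl, show gi ≫ fi = gj ≫ fj from Subsingleton.elim _ _, Functor.map_comp,
        Scheme.Hom.comp_apply]
      rfl

/-- The toric variety `ℙ` of the fan: the affine toric varieties `U_σ` glued along the open
subsets `U_τ ⊂ U_σ` for faces `τ ⊂ σ`. -/
def toricVariety : Scheme.{0} := colimit S.chartDiagram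

/-- The inclusion `T → ℙ` of the torus `T = Spec ℂ[M] = U_{0}`. -/
def torusInclusion : Spec (CommRingCat.of (Laurent n)) ⟶ S.toricVariety :=
  Spec.map (CommRingCat.ofHom (chartRingToLaurent ⊥)) ≫ colimit.ι S.chartDiagram ⟨⊥, S.bot_mem⟩

/-- The inclusion of `Z_f = {f = 0} ⊂ T` in the toric variety. -/
def hypersurfaceInclusion (f : Laurent n) :
    Spec (CommRingCat.of (Laurent n ⧸ Ideal.span {f})) ⟶ S.toricVariety :=
  Spec.map (CommRingCat.ofHom (Ideal.Quotient.mk (Ideal.span {f}))) ≫ S.torusInclusion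

/-- The ideal sheaf of `Y`, the closure (scheme-theoretic image) of `Z_f` in the toric variety. -/
def closureIdealSheaf (f : Laurent n) : S.toricVariety.IdealSheafData :=
  (S.hypersurfaceInclusion f).ker

end ToricFan

namespace ToricHypersurface

/-- The closed subscheme with ideal sheaf `I` is a Cartier divisor: locally, `I` is generated by
one nonzerodivisor. -/
def IsCartierDivisor {X : Scheme.{0}} (I : X.IdealSheafData) : Prop :=
  ∀ x : X, ∃ U : X.affineOpens, x ∈ U.1 ∧
    ∃ g ∈ nonZeroDivisors Γ(X, U.1), I.ideal U = Ideal.span {g}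

/-- The Newton polytope of a Laurent polynomial. -/
def newtonPolytope {n : ℕ} (f : Laurent n) : Set (Fin n → ℝ) :=
  convexHull ℝ (toReal '' (f.coeff.support : Set (Fin n → ℤ)))

end ToricHypersurface

end

/-!
On the chart `U_σ` of a cone `σ` with ray generators `ν_i`, the
ideal of `Y` is `f ℂ[M] ∩ ℂ[σ^∨ ∩ M]`. Because the least weight of a product of Laurent polynomials
with respect to `ν_i` is the sum of the least weights (`le_add_of_forall_support_mul`), this ideal
is `f` times the span of the monomials `x^m` with `⟨m, ν_i⟩ ≥ -Min_Δ(ν_i)` for all `i`. So `Y` is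
Cartier along `U_σ` as soon as some lattice vector `u_σ` satisfies `⟨u_σ, ν_i⟩ = Min_Δ(ν_i)` for all
`i`: then `f x^{-u_σ}` generates the ideal (`exists_chart_generator`).

Conversely, let `σ` be full-dimensional and let `Y` be Cartier at the torus fixed point of `U_σ`.
The weight `∑ ν_i` is positive on `σ^∨ ∩ M` away from `0`, and comparing terms of least weight shows
that a monomial module that is principal near the fixed point is generated by one monomial
(`exists_monomial_generator`), whose exponent is `-u_σ` for such a vector `u_σ`
(`exists_lattice_vector_of_isCartierDivisor`).

On the side of polytopes, the refinement hypothesis gives for each cone `σ` a point `x_σ ∈ C(Δ)` at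
which all forms in `σ` are minimal, and `⟨x_σ, ν_i⟩ = Min_Δ(ν_i)` because `ν_i ∈ S_F(Δ)` and
`Δ ⊂ C(Δ)`. If `C(Δ)` is a lattice polytope, then `x_σ` may be taken to be a lattice point, and it
serves as `u_σ`. If `Y` is Cartier, then `x_σ = u_σ` for every full-dimensional `σ`, since the `ν_i`
span; and `C(Δ)` is the convex hull of these `x_σ`: a point of `C(Δ)` outside it would be separated
from it by an open set of forms, which meets some full-dimensional cone of the complete fan
(`IsComplete.exists_mem_fullDimensional`).
-/

namespace ToricHypersurface

variable {n : ℕ}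

/-! ### Lattice vectors and cones -/

lemma toReal_dotProduct_toReal (m ν : Fin n → ℤ) :
    toReal m ⬝ᵥ toReal ν = ((m ⬝ᵥ ν : ℤ) : ℝ) := by
  simp [toReal, dotProduct]

lemma toReal_injective : Function.Injective (toReal (n := n)) := by
  intro a b h
  ext i
  simpa [toReal] using congrFun h i

lemma toReal_zsmul (k : ℤ) (a : Fin n → ℤ) : toReal (k • a) = (k : ℝ) • toReal a := by
  ext; simp [toReal]

/-- A linear form that is nonnegative on a set of generators of a cone is nonnegative on the cone,
and the elements at which it vanishes are generated by the generators at which it vanishes. -/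
lemma hull_nonneg_and_mem_face {t : Set (Fin n → ℝ)} (l : Fin n → ℝ) (h : ∀ x ∈ t, 0 ≤ l ⬝ᵥ x)
    {v : Fin n → ℝ} (hv : v ∈ PointedCone.hull ℝ t) :
    0 ≤ l ⬝ᵥ v ∧ (l ⬝ᵥ v = 0 → v ∈ PointedCone.hull ℝ {x ∈ t | l ⬝ᵥ x = 0}) := by
  induction hv using Submodule.span_induction with
  | mem x hx => exact ⟨h x hx, fun h0 => PointedCone.subset_hull ⟨hx, h0⟩⟩
  | zero => simp
  | add x y _ _ hx hy =>
    rw [dotProduct_add]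
    exact ⟨add_nonneg hx.1 hy.1, fun h0 => add_mem (hx.2 (by linarith [hx.1, hy.1]))
      (hy.2 (by linarith [hx.1, hy.1]))⟩
  | smul c x _ hx =>
    have e : c • x = (c : ℝ) • x := rfl
    rw [e, dotProduct_smul, smul_eq_mul, ← e]
    refine ⟨mul_nonneg c.2 hx.1, fun h0 => ?_⟩
    rcases mul_eq_zero.1 h0 with h0 | h0
    · have : c = 0 := Subtype.ext h0
      simp [this]
    · exact Submodule.smul_mem _ _ (hx.2 h0)

lemma mem_dualMonoid_hull {ι : Type*} (ν : ι → Fin n → ℤ) (m : Fin n → ℤ) :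
    m ∈ dualMonoid (PointedCone.hull ℝ (Set.range fun i => toReal (ν i))) ↔
      ∀ i, 0 ≤ m ⬝ᵥ ν i := by
  constructor
  · intro h i
    have := h _ (PointedCone.subset_hull ⟨i, rfl⟩)
    rw [toReal_dotProduct_toReal] at this
    exact_mod_cast this
  · intro h v hv
    refine (hull_nonneg_and_mem_face _ ?_ hv).1
    rintro _ ⟨i, rfl⟩
    simp only [toReal_dotProduct_toReal]
    exact_mod_cast h i

/-- The integral form is found inside the lattice spanned by the vectors: its coefficients are
obtained by inverting their Gram matrix up to its determinant. -/
lemma exists_int_form_of_linearIndependent {ι : Type*} [Fintype ι] {ν : ι → Fin n → ℤ}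
    (hν : LinearIndependent ℝ fun i => toReal (ν i)) (i : ι) :
    ∃ m : Fin n → ℤ, m ⬝ᵥ ν i = 0 ∧ ∀ j, j ≠ i → 0 < m ⬝ᵥ ν j := by
  classical
  let G : Matrix ι ι ℤ := Matrix.of fun j k => ν k ⬝ᵥ ν j
  have hG : ∀ c j, (G.mulVec c) j = (∑ k, c k • ν k) ⬝ᵥ ν j := by
    intro c j
    rw [sum_dotProduct]
    simp [Matrix.mulVec, G, dotProduct, Finset.mul_sum, mul_comm, mul_left_comm]
  have hdet : G.det ≠ 0 := by
    intro h0
    obtain ⟨c, hc, hGc⟩ := Matrix.exists_mulVec_eq_zero_iff.2 h0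
    have h1 : (∑ k, c k • ν k) ⬝ᵥ (∑ k, c k • ν k) = 0 := by
      conv_lhs => rw [dotProduct_sum]
      refine Finset.sum_eq_zero fun j _ => ?_
      rw [dotProduct_smul, ← hG, hGc]
      simp
    have h2 := dotProduct_self_eq_zero.1 h1
    refine hc (funext fun k => ?_)
    have h3 : ∑ k, (c k : ℝ) • toReal (ν k) = 0 := by
      have : toReal (∑ k, c k • ν k) = ∑ k, (c k : ℝ) • toReal (ν k) := by
        ext; simp [toReal]
      rw [← this, h2]
      ext; simp [toReal]
    simpa using Fintype.linearIndependent_iff.1 hν (fun k => (c k : ℝ)) h3 k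
  let b : ι → ℤ := fun j => if j = i then 0 else G.det
  let c := G.adjugate.mulVec b
  have hc : G.mulVec c = G.det • b := by
    simp [c, Matrix.mulVec_mulVec, Matrix.mul_adjugate]
  refine ⟨∑ k, c k • ν k, ?_, fun j hj => ?_⟩
  · rw [← hG, hc]; simp [b]
  · rw [← hG, hc]
    simp only [Pi.smul_apply, b, if_neg hj, smul_eq_mul]
    exact mul_self_pos.2 hdet

/-- A nonzero lattice vector is a positive multiple of a primitive one. -/
lemma exists_primitive {a : Fin n → ℤ} (ha : a ≠ 0) :
    ∃ (k : ℤ) (ν : Fin n → ℤ), 0 < k ∧ a = k • ν ∧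
      ∀ (k : ℤ) (w : Fin n → ℤ), ν = k • w → IsUnit k := by
  obtain ⟨i₀, hi₀⟩ := Function.ne_iff.1 ha
  obtain ⟨ν, h, hν⟩ := Finset.extract_gcd a ⟨i₀, Finset.mem_univ i₀⟩
  refine ⟨Finset.univ.gcd a, ν, ?_, ?_, ?_⟩
  · refine lt_of_le_of_ne (Int.nonneg_of_normalize_eq_self Finset.normalize_gcd) ?_
    intro h0
    exact hi₀ (by rw [h i₀ (Finset.mem_univ _), ← h0]; simp)
  · ext i; simpa using h i (Finset.mem_univ _)
  · intro k w hw
    refine isUnit_of_dvd_one (hν ▸ Finset.dvd_gcd fun i _ => ?_)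
    rw [hw]
    exact ⟨w i, by simp⟩

/-- Every generator of a simplicial rational cone is, up to a positive factor, a primitive lattice
vector: the ray it spans is a face, and so contains one of the rational generators. -/
lemma exists_primitive_smul {t : Set (Fin n → ℝ)} (ht : LinearIndepOn ℝ id t)
    (hr : IsRationalPolyhedral (PointedCone.hull ℝ t)) {b : Fin n → ℝ} (hb : b ∈ t) :
    ∃ (c : ℝ) (ν : Fin n → ℤ), 0 < c ∧ toReal ν = c • b ∧
      ∀ (k : ℤ) (w : Fin n → ℤ), ν = k • w → IsUnit k := by
  classical
  obtain ⟨u, hu⟩ := hr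
  -- a real linear form that vanishes at `b` and is `1` at the other generators
  obtain ⟨l, hl⟩ : ∃ l : Fin n → ℝ, ∀ x ∈ t, l ⬝ᵥ x = if x = b then 0 else 1 := by
    let B := Module.Basis.extend ht
    let φ := B.constr ℝ fun x => if (x : Fin n → ℝ) = b then (0 : ℝ) else 1
    refine ⟨(dotProductEquiv ℝ (Fin n)).symm φ, fun x hx => ?_⟩
    have h1 := B.constr_basis ℝ (fun x => if (x : Fin n → ℝ) = b then (0 : ℝ) else 1)
      ⟨x, ht.subset_extend _ hx⟩
    have h2 : B ⟨x, ht.subset_extend _ hx⟩ = x := by simp [B]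
    rw [h2] at h1
    rw [← h1]
    exact LinearMap.congr_fun ((dotProductEquiv ℝ (Fin n)).apply_symm_apply φ) x
  have hl0 : ∀ x ∈ t, 0 ≤ l ⬝ᵥ x := fun x hx => by rw [hl x hx]; split_ifs <;> norm_num
  have hface : {x ∈ t | l ⬝ᵥ x = 0} = {b} := by
    ext x
    constructor
    · rintro ⟨hx, h0⟩
      by_contra hne
      have hne' : x ≠ b := hne
      simp [hl x hx, hne'] at h0
    · rintro rfl
      exact ⟨hb, by rw [hl _ hb, if_pos rfl]⟩
  have hb0 : b ≠ 0 := ht.ne_zero (i := b) hb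
  have hbu : b ∈ PointedCone.hull ℝ (toReal '' (u : Set (Fin n → ℤ))) :=
    hu ▸ PointedCone.subset_hull hb
  have hmem : ∀ x ∈ toReal '' (u : Set (Fin n → ℤ)), x ∈ PointedCone.hull ℝ t := fun x hx => by
    rw [hu]; exact PointedCone.subset_hull hx
  have hlu : ∀ x ∈ toReal '' (u : Set (Fin n → ℤ)), 0 ≤ l ⬝ᵥ x := fun x hx =>
    (hull_nonneg_and_mem_face l hl0 (hmem x hx)).1
  have hbf := (hull_nonneg_and_mem_face l hlu hbu).2 (by rw [hl b hb, if_pos rfl])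
  obtain ⟨a, ha, hla, ha0⟩ : ∃ a ∈ u, l ⬝ᵥ toReal a = 0 ∧ toReal a ≠ 0 := by
    by_contra! hcon
    have : PointedCone.hull ℝ {x ∈ toReal '' (u : Set (Fin n → ℤ)) | l ⬝ᵥ x = 0} ≤ ⊥ := by
      refine Submodule.span_le.2 ?_
      rintro _ ⟨⟨a, ha, rfl⟩, h0⟩
      exact hcon a ha h0
    exact hb0 (by simpa using this hbf)
  have hab := (hull_nonneg_and_mem_face l hl0 (hmem _ ⟨a, ha, rfl⟩)).2 hla
  rw [hface] at hab
  obtain ⟨c, hc⟩ := Submodule.mem_span_singleton.1 hab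
  have hc' : (c : ℝ) • b = toReal a := hc
  have hcpos : 0 < (c : ℝ) := by
    refine lt_of_le_of_ne c.2 fun h0 => ha0 ?_
    rw [← hc', ← h0, zero_smul]
  obtain ⟨k, ν, hk, rfl, hprim⟩ := exists_primitive (a := a) (by
    rintro rfl; exact ha0 (by ext; simp [toReal]))
  have hk' : (0 : ℝ) < k := by exact_mod_cast hk
  refine ⟨c / k, ν, by positivity, ?_, hprim⟩
  rw [toReal_zsmul] at hc'
  rw [div_eq_inv_mul, mul_smul, hc', smul_smul, inv_mul_cancel₀ hk'.ne', one_smul]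

end ToricHypersurface

namespace ToricFan

open ToricHypersurface

variable {n : ℕ} {S : ToricFan n}

/-- A cone of a simplicial fan is generated by linearly independent ray generators of the fan. -/
lemma IsSimplicial.exists_rayGenerators (hS : S.IsSimplicial) {σ : Cone n} (hσ : σ ∈ S.cones) :
    ∃ (ι : Type) (_ : Fintype ι) (ν : ι → Fin n → ℤ), (∀ i, ν i ∈ S.rayGenerators) ∧
      LinearIndependent ℝ (fun i => toReal (ν i)) ∧
      σ = PointedCone.hull ℝ (Set.range fun i => toReal (ν i)) := by
  obtain ⟨t, htf, ht, rfl⟩ := hS σ hσ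
  have key := fun b : t => exists_primitive_smul ht (S.rational _ hσ) b.2
  choose c ν hc hν hprim using key
  have hLI : LinearIndependent ℝ fun i => toReal (ν i) := by
    have := LinearIndependent.units_smul ht fun b => Units.mk0 (c b) (hc b).ne'
    convert this using 1
    ext b : 1
    exact hν b
  have hhull : PointedCone.hull ℝ t = PointedCone.hull ℝ (Set.range fun i => toReal (ν i)) := by
    refine le_antisymm (Submodule.span_le.2 fun b hb => ?_) (Submodule.span_le.2 ?_)
    · have h1 : b = (⟨(c ⟨b, hb⟩)⁻¹, (inv_pos.2 (hc _)).le⟩ : {r : ℝ // 0 ≤ r}) •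
          toReal (ν ⟨b, hb⟩) := by
        change b = (c ⟨b, hb⟩)⁻¹ • toReal (ν ⟨b, hb⟩)
        rw [hν, smul_smul, inv_mul_cancel₀ (hc _).ne', one_smul]
      rw [h1]
      exact Submodule.smul_mem _ _ (PointedCone.subset_hull ⟨_, rfl⟩)
    · rintro _ ⟨b, rfl⟩
      have h1 : toReal (ν b) = (⟨c b, (hc b).le⟩ : {r : ℝ // 0 ≤ r}) • (b : Fin n → ℝ) := hν b
      simp only [h1]
      exact Submodule.smul_mem _ _ (PointedCone.subset_hull b.2)
  have := htf.fintype
  refine ⟨t, htf.fintype, ν, fun i => ⟨hprim i, S.face_mem _ hσ _ ?_⟩, hLI, hhull⟩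
  obtain ⟨m, hm0, hm⟩ := exists_int_form_of_linearIndependent hLI i
  have hpos : ∀ x ∈ Set.range fun i => toReal (ν i), 0 ≤ toReal m ⬝ᵥ x := by
    rintro _ ⟨j, rfl⟩
    simp only [toReal_dotProduct_toReal]
    by_cases hj : j = i
    · rw [hj, hm0]; simp
    · exact_mod_cast (hm j hj).le
  have hface : {x ∈ Set.range fun i => toReal (ν i) | toReal m ⬝ᵥ x = 0} = {toReal (ν i)} := by
    ext x
    constructor
    · rintro ⟨⟨j, rfl⟩, h0⟩
      by_contra hne
      have hj : j ≠ i := by rintro rfl; exact hne rfl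
      simp only [toReal_dotProduct_toReal] at h0
      exact (hm j hj).ne' (by exact_mod_cast h0)
    · rintro rfl
      exact ⟨⟨i, rfl⟩, by rw [toReal_dotProduct_toReal, hm0]; simp⟩
  rw [hhull]
  refine ⟨m, fun v hv => (hull_nonneg_and_mem_face _ hpos hv).1, fun v => ⟨fun hv => ?_, ?_⟩⟩
  · refine ⟨Submodule.span_mono (by rintro _ rfl; exact ⟨i, rfl⟩) hv, ?_⟩
    obtain ⟨c, rfl⟩ := Submodule.mem_span_singleton.1 hv
    change toReal m ⬝ᵥ ((c : ℝ) • toReal (ν i)) = 0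
    rw [dotProduct_smul, toReal_dotProduct_toReal, hm0]
    simp
  · rintro ⟨hv, h0⟩
    rw [← hface]
    exact (hull_nonneg_and_mem_face _ hpos hv).2 h0

/-- In a complete fan the vectors that lie in a full-dimensional cone are dense, since the remaining
cones lie in finitely many proper subspaces. -/
lemma IsComplete.exists_mem_fullDimensional (hS : S.IsComplete) {O : Set (Fin n → ℝ)}
    (hO : IsOpen O) (hne : O.Nonempty) :
    ∃ σ ∈ S.cones, Submodule.span ℝ (σ : Set (Fin n → ℝ)) = ⊤ ∧ ∃ v ∈ σ, v ∈ O := by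
  by_contra! hcon
  have hnull : MeasureTheory.volume (⋃ σ ∈ {σ ∈ S.cones | Submodule.span ℝ
      (σ : Set (Fin n → ℝ)) ≠ ⊤}, (Submodule.span ℝ (σ : Set (Fin n → ℝ)) : Set (Fin n → ℝ))) = 0 :=
    (MeasureTheory.measure_biUnion_null_iff (S.finite.subset fun _ h => h.1).countable).2
      fun σ hσ => MeasureTheory.Measure.addHaar_submodule _ _ hσ.2
  refine (hO.measure_pos MeasureTheory.volume hne).ne' (MeasureTheory.measure_mono_null ?_ hnull)
  intro v hv
  obtain ⟨σ, hσ, hvσ⟩ := hS v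
  exact Set.mem_biUnion (x := σ) ⟨hσ, fun htop => hcon σ hσ htop v hvσ hv⟩
    (Submodule.subset_span hvσ)

end ToricFan

namespace ToricHypersurface

variable {n : ℕ}

/-! ### Minima over lattice polytopes -/

/-- A linear form on a lattice polytope attains its minimum at one of the generating points. -/
lemma exists_minOn_convexHull {K : Finset (Fin n → ℤ)} (hK : K.Nonempty) (ν : Fin n → ℤ) :
    ∃ w ∈ K, minOn (convexHull ℝ (toReal '' (K : Set (Fin n → ℤ)))) ν = ((w ⬝ᵥ ν : ℤ) : ℝ) ∧
      (∀ w' ∈ K, w ⬝ᵥ ν ≤ w' ⬝ᵥ ν) ∧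
      ∀ y ∈ convexHull ℝ (toReal '' (K : Set (Fin n → ℤ))), ((w ⬝ᵥ ν : ℤ) : ℝ) ≤ y ⬝ᵥ toReal ν := by
  obtain ⟨w, hw, hmin⟩ := K.exists_min_image (fun w => w ⬝ᵥ ν) hK
  have hle : ∀ y ∈ convexHull ℝ (toReal '' (K : Set (Fin n → ℤ))),
      ((w ⬝ᵥ ν : ℤ) : ℝ) ≤ y ⬝ᵥ toReal ν := by
    have hconv : Convex ℝ {y : Fin n → ℝ | ((w ⬝ᵥ ν : ℤ) : ℝ) ≤ y ⬝ᵥ toReal ν} :=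
      convex_halfSpace_ge ⟨fun _ _ => add_dotProduct _ _ _, fun _ _ => smul_dotProduct _ _ _⟩ _
    refine fun y hy => convexHull_min ?_ hconv hy
    rintro _ ⟨w', hw', rfl⟩
    change _ ≤ toReal w' ⬝ᵥ toReal ν
    rw [toReal_dotProduct_toReal]
    exact_mod_cast hmin w' hw'
  refine ⟨w, hw, IsLeast.csInf_eq ⟨⟨toReal w, subset_convexHull ℝ _ ⟨w, hw, rfl⟩,
    toReal_dotProduct_toReal _ _⟩, ?_⟩, hmin, hle⟩
  rintro _ ⟨y, hy, rfl⟩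
  exact hle y hy

end ToricHypersurface

namespace ToricHypersurface

variable {n : ℕ}

/-! ### Laurent polynomials -/

/-- The least weight of a product of Laurent polynomials is the sum of the least weights, so a
lower bound for the weights of `f * g` bounds the weight of each monomial of `g` from below. -/
lemma le_add_of_forall_support_mul {f g : Laurent n} {ν w : Fin n → ℤ} {k : ℤ}
    (hw : w ∈ f.coeff.support) (hmin : ∀ w' ∈ f.coeff.support, w ⬝ᵥ ν ≤ w' ⬝ᵥ ν)
    (hfg : ∀ m ∈ (f * g).coeff.support, k ≤ m ⬝ᵥ ν) {m : Fin n → ℤ} (hm : m ∈ g.coeff.support) :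
    k ≤ m ⬝ᵥ ν + w ⬝ᵥ ν := by
  classical
  obtain ⟨u, hu, humin⟩ := g.coeff.support.exists_min_image (fun m => m ⬝ᵥ ν) ⟨m, hm⟩
  -- a sum that is attained once among the monomials of least weight is attained once altogether
  obtain ⟨a, ha, b, hb, hab⟩ := UniqueSums.uniqueAdd_of_nonempty
    (A := f.coeff.support.filter fun x => x ⬝ᵥ ν = w ⬝ᵥ ν)
    (B := g.coeff.support.filter fun x => x ⬝ᵥ ν = u ⬝ᵥ ν)
    ⟨w, Finset.mem_filter.2 ⟨hw, rfl⟩⟩ ⟨u, Finset.mem_filter.2 ⟨hu, rfl⟩⟩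
  rw [Finset.mem_filter] at ha hb
  have huniq : UniqueAdd f.coeff.support g.coeff.support a b := by
    intro x y hx hy hxy
    have h := congrArg (fun z => z ⬝ᵥ ν) hxy
    simp only [add_dotProduct, ha.2, hb.2] at h
    have h1 := hmin x hx
    have h2 := humin y hy
    exact hab (Finset.mem_filter.2 ⟨hx, by linarith⟩) (Finset.mem_filter.2 ⟨hy, by linarith⟩) hxy
  have hne : a + b ∈ (f * g).coeff.support := by
    rw [Finsupp.mem_support_iff, AddMonoidAlgebra.coeff_mul_add_of_uniqueAdd huniq]
    exact mul_ne_zero (Finsupp.mem_support_iff.1 ha.1) (Finsupp.mem_support_iff.1 hb.1)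
  have h1 := hfg _ hne
  rw [add_dotProduct, ha.2, hb.2] at h1
  linarith [humin m hm]

lemma exists_add_of_mem_support_mul {f g : Laurent n} {m : Fin n → ℤ}
    (hm : m ∈ (f * g).coeff.support) :
    ∃ a ∈ f.coeff.support, ∃ b ∈ g.coeff.support, a + b = m := by
  classical
  exact Finset.mem_add.1 (AddMonoidAlgebra.support_coeff_mul_subset f g hm)

lemma coeff_chartRingToLaurent (σ : Cone n) (a : chartRing σ) (m : dualMonoid σ) :
    (chartRingToLaurent σ a).coeff m = a.coeff m :=
  Finsupp.mapDomain_apply Subtype.val_injective _ _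

lemma chartRingToLaurent_injective (σ : Cone n) : Function.Injective (chartRingToLaurent σ) :=
  AddMonoidAlgebra.mapDomain_injective Subtype.val_injective

lemma mem_dualMonoid_of_mem_support {σ : Cone n} {a : chartRing σ} {m : Fin n → ℤ}
    (hm : m ∈ (chartRingToLaurent σ a).coeff.support) : m ∈ dualMonoid σ := by
  classical
  obtain ⟨x, -, rfl⟩ := Finset.mem_image.1 (Finsupp.mapDomain_support hm)
  exact x.2

lemma exists_chartRingToLaurent_eq {σ : Cone n} {x : Laurent n}
    (hx : ∀ m ∈ x.coeff.support, m ∈ dualMonoid σ) : ∃ a, chartRingToLaurent σ a = x := by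
  rw [← AddMonoidAlgebra.sum_coeff_single x, Finsupp.sum]
  refine ⟨∑ m ∈ x.coeff.support.attach, .single ⟨m, hx _ m.2⟩ (x.coeff m), ?_⟩
  rw [map_sum, ← Finset.sum_attach x.coeff.support]
  refine Finset.sum_congr rfl fun m _ => ?_
  simp [chartRingToLaurent]

/-- Let `D` be a monoid of monomials on which a weight is positive away from `0`, and let `d` be
supported in a set `P` of monomials. If each monomial in `P` is a multiple of `d` after
multiplication by a polynomial on `D` with nonzero constant term, then all monomials in `P` are
multiples of one of them by elements of `D`. Such a monomial is a term of `d` of least weight. -/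
lemma exists_monomial_generator (D : AddSubmonoid (Fin n → ℤ)) (wt : (Fin n → ℤ) →+ ℤ)
    (hwt : ∀ m ∈ D, 0 ≤ wt m) (hwt0 : ∀ m ∈ D, wt m = 0 → m = 0)
    {P : Set (Fin n → ℤ)} (hP : P.Nonempty) {d : Laurent n} (hd : ∀ m ∈ d.coeff.support, m ∈ P)
    (h : ∀ m ∈ P, ∃ s c : Laurent n, (∀ a ∈ s.coeff.support, a ∈ D) ∧
      (∀ a ∈ c.coeff.support, a ∈ D) ∧ s.coeff 0 ≠ 0 ∧
      s * AddMonoidAlgebra.single m 1 = c * d) :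
    ∃ b ∈ P, ∀ m ∈ P, m - b ∈ D := by
  classical
  have hcoeff : ∀ (s : Laurent n) (m : Fin n → ℤ),
      (s * AddMonoidAlgebra.single m 1).coeff m = s.coeff 0 := by
    intro s m
    rw [AddMonoidAlgebra.coeff_mul_single_apply, add_neg_cancel, mul_one]
  have hd0 : d.coeff.support.Nonempty := by
    obtain ⟨m, hm⟩ := hP
    obtain ⟨s, c, -, -, hs0, he⟩ := h m hm
    rw [Finset.nonempty_iff_ne_empty]
    intro hempty
    have : d = 0 := AddMonoidAlgebra.coeff_eq_zero.1 (Finsupp.support_eq_empty.1 hempty)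
    rw [this, mul_zero] at he
    apply hs0
    rw [← hcoeff s m, he]
    simp
  obtain ⟨b, hb, hmin⟩ := d.coeff.support.exists_min_image wt hd0
  obtain ⟨s, c, hs, hc, hs0, he⟩ := h b (hd b hb)
  -- minimality of the weight of `b` forces `c` to have a nonzero constant term
  have hc0 : (0 : Fin n → ℤ) ∈ c.coeff.support := by
    have hbm : b ∈ (c * d).coeff.support := by
      rw [Finsupp.mem_support_iff, ← he, hcoeff]; exact hs0
    obtain ⟨a, ha, b', hb', hab⟩ := exists_add_of_mem_support_mul hbm
    have h1 := congrArg wt hab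
    rw [map_add] at h1
    have : a = 0 := hwt0 a (hc a ha) (by linarith [hwt a (hc a ha), hmin b' hb'])
    exact this ▸ ha
  refine ⟨b, hd b hb, fun m hm => ?_⟩
  obtain ⟨s', c', hs', hc', hs0', he'⟩ := h m hm
  have hrel : s' * c * AddMonoidAlgebra.single m 1 = c' * s * AddMonoidAlgebra.single b 1 := by
    calc s' * c * AddMonoidAlgebra.single m 1 = c * (s' * AddMonoidAlgebra.single m 1) := by ring
      _ = c' * (s * AddMonoidAlgebra.single b 1) := by rw [he', he]; ring
      _ = _ := by ring
  have h0 : (s' * c).coeff 0 = s'.coeff 0 * c.coeff 0 := by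
    have hu : UniqueAdd s'.coeff.support c.coeff.support 0 0 := by
      intro x y hx hy hxy
      have h1 := congrArg wt hxy
      simp only [map_add, map_zero, add_zero] at h1
      have hx' := hwt x (hs' x hx)
      have hy' := hwt y (hc y hy)
      exact ⟨hwt0 x (hs' x hx) (by linarith), hwt0 y (hc y hy) (by linarith)⟩
    simpa using AddMonoidAlgebra.coeff_mul_add_of_uniqueAdd hu
  have hmm : m ∈ (c' * s * AddMonoidAlgebra.single b 1).coeff.support := by
    rw [Finsupp.mem_support_iff, ← hrel, hcoeff, h0]
    exact mul_ne_zero hs0' (Finsupp.mem_support_iff.1 hc0)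
  rw [Finsupp.mem_support_iff, AddMonoidAlgebra.coeff_mul_single_apply, mul_one] at hmm
  obtain ⟨x, hx, y, hy, hxy⟩ := exists_add_of_mem_support_mul (Finsupp.mem_support_iff.2 hmm)
  rw [sub_eq_add_neg, ← hxy]
  exact add_mem (hc' x hx) (hs y hy)

/-- The constant term of a function on an affine toric variety with a torus fixed point: its value
at that point. -/
def constantTerm (σ : Cone n) (hσ : ∀ m ∈ dualMonoid σ, -m ∈ dualMonoid σ → m = 0) :
    chartRing σ →+* ℂ where
  toFun a := a.coeff 0
  map_one' := by simp [AddMonoidAlgebra.one_def]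
  map_zero' := rfl
  map_add' _ _ := rfl
  map_mul' a b := by
    have hu : UniqueAdd a.coeff.support b.coeff.support 0 0 := by
      intro x y _ _ hxy
      rw [add_zero] at hxy
      have hxy' : (x : Fin n → ℤ) + y = 0 := congrArg Subtype.val hxy
      have hx := hσ x x.2 (by rw [neg_eq_of_add_eq_zero_right hxy']; exact y.2)
      have hy : (y : Fin n → ℤ) = 0 := by rwa [hx, zero_add] at hxy'
      exact ⟨Subtype.ext hx, Subtype.ext hy⟩
    simpa using AddMonoidAlgebra.coeff_mul_add_of_uniqueAdd hu

end ToricHypersurface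

namespace ToricHypersurface

variable {n : ℕ}

/-! ### Ideals of closed subschemes in affine charts -/

/-- An ideal that becomes principal in the localization at `h` is principal up to powers of `h`. -/
lemma exists_generator_up_to_pow {A B : Type*} [CommRing A] [CommRing B] [Algebra A B] (h : A)
    [IsLocalization.Away h B] {J : Ideal A} {g : B}
    (hJ : J.map (algebraMap A B) = Ideal.span {g}) :
    ∃ j ∈ J, ∀ a ∈ J, ∃ (N : ℕ) (c : A), h ^ N * a = c * j := by
  have hg : g ∈ J.map (algebraMap A B) := hJ ▸ Ideal.mem_span_singleton_self g
  obtain ⟨⟨j, ⟨_, k, rfl⟩⟩, hj⟩ :=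
    (IsLocalization.mem_map_algebraMap_iff (Submonoid.powers h) B).1 hg
  refine ⟨j, j.2, fun a ha => ?_⟩
  obtain ⟨b, hb⟩ := Ideal.mem_span_singleton'.1 (hJ ▸ Ideal.mem_map_of_mem _ ha)
  obtain ⟨m, c, hc⟩ := IsLocalization.Away.surj h b
  have key : algebraMap A B (h ^ (m + k) * a) = algebraMap A B (c * j) := by
    simp only [map_mul, map_pow] at hj ⊢
    rw [← hj, ← hc, ← hb]
    ring
  obtain ⟨l, hl⟩ := IsLocalization.Away.exists_of_eq h key
  exact ⟨l + (m + k), h ^ l * c, by linear_combination hl⟩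

variable {X : Scheme.{0}} {A B : Type} [CommRing A] [CommRing B]

/-- The coordinate ring of an affine chart is the ring of functions on its image. -/
noncomputable def chartEquiv (i : Spec (CommRingCat.of A) ⟶ X) [IsOpenImmersion i] :
    Γ(X, i ''ᵁ ⊤) ≃+* A :=
  (i.appIso ⊤ ≪≫ Scheme.ΓSpecIso (CommRingCat.of A)).commRingCatIsoToRingEquiv

/-- The ideal, in a chart, of the scheme-theoretic image of a morphism that factors through it. -/
lemma mem_ker_ideal_iff (i : Spec (CommRingCat.of A) ⟶ X) [IsOpenImmersion i] (φ : A →+* B)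
    {f : Spec (CommRingCat.of B) ⟶ X} (hf : f = Spec.map (CommRingCat.ofHom φ) ≫ i)
    [QuasiCompact f] (x : Γ(X, i ''ᵁ ⊤)) :
    x ∈ f.ker.ideal ⟨i ''ᵁ ⊤, (isAffineOpen_top _).image_of_isOpenImmersion _⟩ ↔
      φ (chartEquiv i x) = 0 := by
  rw [Scheme.Hom.ker_apply, RingHom.mem_ker]
  have hpre : f ⁻¹ᵁ (i ''ᵁ ⊤) = ⊤ := by
    rw [hf, Scheme.Hom.comp_preimage, Scheme.Hom.preimage_image_eq]
    rfl
  let e : Γ(Spec (CommRingCat.of B), f ⁻¹ᵁ (i ''ᵁ ⊤)) ≅ CommRingCat.of B :=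
    (Spec (CommRingCat.of B)).presheaf.mapIso (eqToIso hpre.symm).op ≪≫
      Scheme.ΓSpecIso (CommRingCat.of B)
  have h : f.app (i ''ᵁ ⊤) ≫ e.hom =
      (i.appIso ⊤).hom ≫ (Scheme.ΓSpecIso (CommRingCat.of A)).hom ≫ CommRingCat.ofHom φ := by
    rw [← Scheme.ΓSpecIso_naturality]
    subst hf
    rw [Scheme.Hom.app_eq_appLE, Scheme.Hom.appIso_hom']
    simp only [e, Iso.trans_hom, Functor.mapIso_hom, Iso.op_hom, eqToIso.hom]
    rw [Scheme.Hom.appLE_map_assoc, ← Scheme.Hom.appLE_comp_appLE _ _ _ ⊤ _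
      (i.preimage_image_eq ⊤).ge le_top,
      Category.assoc]
    simp [Scheme.Hom.app_eq_appLE]
  have h1 := congr($(h).hom x)
  rw [← map_eq_zero_iff e.hom.hom (ConcreteCategory.bijective_of_isIso e.hom).1]
  exact Eq.congr h1 rfl

lemma mem_basicOpen_iff (i : Spec (CommRingCat.of A) ⟶ X) [IsOpenImmersion i]
    (y : PrimeSpectrum A) (x : Γ(X, i ''ᵁ ⊤)) :
    i y ∈ X.basicOpen x ↔ chartEquiv i x ∉ y.asIdeal := by
  have h := Scheme.image_basicOpen i ((i.appIso ⊤).hom x)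
  have h2 : (i.appIso ⊤).inv ((i.appIso ⊤).hom x) = x := by simp
  rw [h2] at h
  rw [← h, basicOpen_eq_of_affine']
  exact i.isOpenEmbedding.injective.mem_set_image

end ToricHypersurface

namespace ToricFan

/-! ### The charts of the toric variety -/

open ToricHypersurface

variable {n : ℕ} (S : ToricFan n)

/-- The inclusion of the affine toric variety `U_σ` in the toric variety. -/
noncomputable def chart (σ : S.cones) : Spec (CommRingCat.of (chartRing σ.1)) ⟶ S.toricVariety :=
  colimit.ι S.chartDiagram σ

instance (σ : S.cones) : IsOpenImmersion (S.chart σ) :=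
  inferInstanceAs (IsOpenImmersion (colimit.ι S.chartDiagram σ))

lemma exists_chart_eq (x : S.toricVariety) : ∃ (σ : S.cones) (y : PrimeSpectrum (chartRing σ.1)),
    S.chart σ y = x :=
  Scheme.IsLocallyDirected.ι_jointly_surjective S.chartDiagram x

/-- The inclusion of `Z_f` factors through every chart. -/
lemma hypersurfaceInclusion_eq (f : Laurent n) (σ : S.cones) :
    S.hypersurfaceInclusion f = Spec.map (CommRingCat.ofHom
      ((Ideal.Quotient.mk (Ideal.span {f})).comp (chartRingToLaurent σ.1))) ≫ S.chart σ := by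
  have hle : (⊥ : Cone n) ≤ σ.1 := bot_le
  let g : (⟨⊥, S.bot_mem⟩ : S.cones) ⟶ σ := homOfLE hle
  have h1 : colimit.ι S.chartDiagram ⟨⊥, S.bot_mem⟩ = S.chartDiagram.map g ≫ S.chart σ :=
    (colimit.w S.chartDiagram g).symm
  have h2 : (chartRingToLaurent ⊥).comp (chartRingMap hle) = chartRingToLaurent σ.1 :=
    (AddMonoidAlgebra.mapDomainRingHom_comp (R := ℂ) (dualMonoid ⊥).subtype
      (AddSubmonoid.inclusion (dualMonoid_anti hle))).symm
  rw [hypersurfaceInclusion, torusInclusion, h1, ← h2]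
  change _ ≫ _ ≫ Spec.map (CommRingCat.ofHom (chartRingMap hle)) ≫ _ = _
  simp only [CommRingCat.ofHom_comp, Spec.map_comp, Category.assoc]

lemma iSup_chart_image_eq_top : ⨆ σ, S.chart σ ''ᵁ ⊤ = ⊤ := by
  refine top_le_iff.1 fun x _ => ?_
  obtain ⟨σ, y, rfl⟩ := S.exists_chart_eq x
  exact TopologicalSpace.Opens.mem_iSup.2 ⟨σ, y, trivial, rfl⟩

/-- The image of the chart `U_σ`. -/
noncomputable def chartOpen (σ : S.cones) : S.toricVariety.affineOpens :=
  ⟨S.chart σ ''ᵁ ⊤, (isAffineOpen_top _).image_of_isOpenImmersion _⟩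

/-- The preimage of every chart is the whole affine scheme `Z_f`, since the torus lies in every
chart. -/
instance (f : Laurent n) : QuasiCompact (S.hypersurfaceInclusion f) := by
  refine (@HasAffineProperty.iff_of_iSup_eq_top _ _
    instHasAffinePropertyQuasiCompactCompactSpaceCarrierCarrierCommRingCat _ _ _ _ S.chartOpen
    S.iSup_chart_image_eq_top).2 fun σ => ?_
  have hpre : S.hypersurfaceInclusion f ⁻¹ᵁ (S.chartOpen σ).1 = ⊤ := by
    rw [S.hypersurfaceInclusion_eq f σ, Scheme.Hom.comp_preimage, chartOpen,
      Scheme.Hom.preimage_image_eq]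
    rfl
  refine isCompact_iff_compactSpace.1 ?_
  rw [hpre]
  exact isCompact_univ

/-- The functions on the image of the chart `U_σ` are its coordinate ring. -/
noncomputable def chartSections (σ : S.cones) :
    Γ(S.toricVariety, (S.chartOpen σ).1) ≃+* chartRing σ.1 :=
  chartEquiv (S.chart σ)

/-- On the chart `U_σ`, the ideal of `Y` consists of the multiples of `f` in `ℂ[M]` that lie in the
coordinate ring of the chart. -/
lemma mem_closureIdealSheaf_iff (f : Laurent n) (σ : S.cones)
    (x : Γ(S.toricVariety, (S.chartOpen σ).1)) :
    x ∈ (S.closureIdealSheaf f).ideal (S.chartOpen σ) ↔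
      chartRingToLaurent σ.1 (S.chartSections σ x) ∈ Ideal.span {f} := by
  rw [closureIdealSheaf]
  refine (mem_ker_ideal_iff (S.chart σ) _ (S.hypersurfaceInclusion_eq f σ) x).trans ?_
  rw [RingHom.comp_apply, Ideal.Quotient.eq_zero_iff_mem]
  rfl

lemma isCartierDivisor_of_forall_chart {f : Laurent n}
    (h : ∀ σ : S.cones, ∃ g : chartRing σ.1, g ≠ 0 ∧
      ∀ a, chartRingToLaurent σ.1 a ∈ Ideal.span {f} ↔ a ∈ Ideal.span {g}) :
    IsCartierDivisor (S.closureIdealSheaf f) := by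
  intro x
  obtain ⟨σ, y, rfl⟩ := S.exists_chart_eq x
  obtain ⟨g, hg0, hg⟩ := h σ
  let e := S.chartSections σ
  have hdom : IsDomain (chartRing σ.1) :=
    (chartRingToLaurent_injective σ.1).isDomain (chartRingToLaurent σ.1)
  have hdom' : IsDomain Γ(S.toricVariety, (S.chartOpen σ).1) := e.toMulEquiv.isDomain _
  refine ⟨S.chartOpen σ, ⟨y, trivial, rfl⟩, e.symm g,
    mem_nonZeroDivisors_of_ne_zero (e.symm.map_ne_zero_iff.2 hg0), ?_⟩
  ext a
  refine (S.mem_closureIdealSheaf_iff f σ a).trans ((hg _).trans ?_)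
  rw [Ideal.mem_span_singleton, Ideal.mem_span_singleton]
  constructor
  · rintro ⟨c, hc⟩
    refine ⟨e.symm c, e.injective ?_⟩
    rw [map_mul, e.apply_symm_apply, e.apply_symm_apply]
    exact hc
  · rintro ⟨c, rfl⟩
    exact ⟨e c, by rw [map_mul]; exact congrArg (· * e c) (e.apply_symm_apply g)⟩

/-- If `Y` is Cartier, then its ideal in a chart becomes principal at every point of the chart. -/
lemma exists_local_generator {f : Laurent n} (h : IsCartierDivisor (S.closureIdealSheaf f))
    (σ : S.cones) (p : PrimeSpectrum (chartRing σ.1)) :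
    ∃ j : chartRing σ.1, chartRingToLaurent σ.1 j ∈ Ideal.span {f} ∧
      ∀ a, chartRingToLaurent σ.1 a ∈ Ideal.span {f} →
        ∃ s ∉ p.asIdeal, ∃ c, s * a = c * j := by
  let I := S.closureIdealSheaf f
  let e := S.chartSections σ
  obtain ⟨U, hU, g, -, hg⟩ := h (S.chart σ p)
  let V := S.chartOpen σ
  have hV : S.chart σ p ∈ V.1 := ⟨p, trivial, rfl⟩
  obtain ⟨u, v, huv, hu⟩ := exists_basicOpen_le_affine_inter U.2 V.2 (S.chart σ p) ⟨hU, hV⟩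
  let W := S.toricVariety.affineBasicOpen v
  have hWU : W ≤ U := by
    change S.toricVariety.basicOpen v ≤ U.1
    rw [← huv]
    exact S.toricVariety.basicOpen_le u
  have hprinc : I.ideal W = Ideal.span {(S.toricVariety.presheaf.map (homOfLE hWU).op).hom g} := by
    rw [← I.map_ideal hWU, hg, Ideal.map_span, Set.image_singleton]
    rfl
  have inst := V.2.isLocalization_basicOpen v
  have hmap : (I.ideal V).map (algebraMap Γ(S.toricVariety, V.1)
      Γ(S.toricVariety, S.toricVariety.basicOpen v)) = I.ideal W := I.map_ideal_basicOpen V v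
  obtain ⟨j, hj, hgen⟩ := exists_generator_up_to_pow v (hmap.trans hprinc)
  refine ⟨e j, (S.mem_closureIdealSheaf_iff f σ j).1 hj, fun a ha => ?_⟩
  have ha' : e.symm a ∈ I.ideal V := (S.mem_closureIdealSheaf_iff f σ _).2 (by
    rwa [show S.chartSections σ (e.symm a) = a from e.apply_symm_apply a])
  obtain ⟨N, c, hc⟩ := hgen _ ha'
  have hv : e v ∉ p.asIdeal := (mem_basicOpen_iff (S.chart σ) p v).1 (huv ▸ hu)
  refine ⟨e v ^ N, fun hmem => hv (p.isPrime.mem_of_pow_mem _ hmem), e c, ?_⟩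
  have h1 := congrArg e hc
  rw [map_mul, map_mul, map_pow, e.apply_symm_apply] at h1
  exact h1

end ToricFan

namespace ToricHypersurface

variable {n : ℕ}

/-! ### The ideal of the hypersurface in a chart -/

/-- Since least weights are additive, `f * d` is regular on the chart of the cone generated by the
vectors `ν i` exactly if the monomials of `d` have weight at least minus the least weight of `f`:
the ideal of `Y` in the chart is `f` times a module spanned by monomials. -/
lemma forall_support_mul_mem_dualMonoid_iff {ι : Type*} {ν w : ι → Fin n → ℤ} {f : Laurent n}
    (hw : ∀ i, w i ∈ f.coeff.support)
    (hmin : ∀ i, ∀ w' ∈ f.coeff.support, w i ⬝ᵥ ν i ≤ w' ⬝ᵥ ν i) (d : Laurent n) :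
    (∀ m ∈ (f * d).coeff.support,
      m ∈ dualMonoid (PointedCone.hull ℝ (Set.range fun i => toReal (ν i)))) ↔
      ∀ m ∈ d.coeff.support, ∀ i, 0 ≤ m ⬝ᵥ ν i + w i ⬝ᵥ ν i := by
  simp only [mem_dualMonoid_hull]
  constructor
  · exact fun h m hm i => le_add_of_forall_support_mul (hw i) (hmin i) (fun m' hm' => h m' hm' i) hm
  · intro h m hm i
    obtain ⟨a, ha, b, hb, rfl⟩ := exists_add_of_mem_support_mul hm
    rw [add_dotProduct]
    linarith [hmin i a ha, h b hb i]

lemma forall_mem_support_single {P : (Fin n → ℤ) → Prop} {m : Fin n → ℤ} (hm : P m) :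
    ∀ a ∈ (AddMonoidAlgebra.single m 1 : Laurent n).coeff.support, P a := by
  intro a ha
  have := Finsupp.support_single_subset ha
  rw [Finset.mem_singleton] at this
  rwa [this]

/-- If the least weights of `f` on the generators of a cone are the weights of one lattice vector
`u`, then the ideal of `Y` in the chart is generated by `f x^{-u}`. -/
lemma exists_chart_generator {ι : Type*} {ν w : ι → Fin n → ℤ} {f : Laurent n} (hf : f ≠ 0)
    (hw : ∀ i, w i ∈ f.coeff.support)
    (hmin : ∀ i, ∀ w' ∈ f.coeff.support, w i ⬝ᵥ ν i ≤ w' ⬝ᵥ ν i)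
    {σ : Cone n} (hσ : σ = PointedCone.hull ℝ (Set.range fun i => toReal (ν i)))
    {u : Fin n → ℤ} (hu : ∀ i, u ⬝ᵥ ν i = w i ⬝ᵥ ν i) :
    ∃ g : chartRing σ, g ≠ 0 ∧
      ∀ a, chartRingToLaurent σ a ∈ Ideal.span {f} ↔ a ∈ Ideal.span {g} := by
  have hmul := forall_support_mul_mem_dualMonoid_iff hw hmin
  rw [← hσ] at hmul
  obtain ⟨g, hg⟩ := exists_chartRingToLaurent_eq ((hmul (.single (-u) 1)).2
    (forall_mem_support_single (P := fun m => ∀ i, 0 ≤ m ⬝ᵥ ν i + w i ⬝ᵥ ν i) fun i => by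
      rw [neg_dotProduct, hu, neg_add_cancel]))
  have hunit : (AddMonoidAlgebra.single (-u) 1 * AddMonoidAlgebra.single u 1 : Laurent n) = 1 := by
    rw [AddMonoidAlgebra.single_mul_single, neg_add_cancel, one_mul]
    rfl
  refine ⟨g, ?_, fun a => ?_⟩
  · rintro rfl
    rw [map_zero] at hg
    refine mul_ne_zero hf (fun h0 => ?_) hg.symm
    rw [h0, zero_mul] at hunit
    exact zero_ne_one hunit
  · rw [Ideal.mem_span_singleton, Ideal.mem_span_singleton]
    constructor
    · rintro ⟨d, hd⟩
      have hdP := (hmul d).1 (hd ▸ fun m hm => mem_dualMonoid_of_mem_support hm)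
      obtain ⟨c, hc⟩ := exists_chartRingToLaurent_eq (σ := σ) (x := d * .single u 1) (by
        intro m hm
        obtain ⟨x, hx, y, hy, rfl⟩ := exists_add_of_mem_support_mul hm
        rw [hσ, mem_dualMonoid_hull]
        intro i
        rw [add_dotProduct, forall_mem_support_single (P := fun m => m = u) rfl y hy, hu]
        exact hdP x hx i)
      refine ⟨c, chartRingToLaurent_injective σ ?_⟩
      rw [map_mul, hg, hc, hd]
      linear_combination (-(f * d)) * hunit
    · rintro ⟨c, rfl⟩
      exact ⟨.single (-u) 1 * chartRingToLaurent σ c, by rw [map_mul, hg, mul_assoc]⟩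

/-- A vector orthogonal to generators of a full-dimensional cone vanishes. -/
lemma eq_zero_of_forall_dotProduct_eq_zero {t : Set (Fin n → ℝ)}
    (ht : Submodule.span ℝ (PointedCone.hull ℝ t : Set (Fin n → ℝ)) = ⊤) {u : Fin n → ℝ}
    (hu : ∀ x ∈ t, u ⬝ᵥ x = 0) : u = 0 := by
  have h : ∀ v, u ⬝ᵥ v = 0 := by
    intro v
    have hv : v ∈ Submodule.span ℝ (PointedCone.hull ℝ t : Set (Fin n → ℝ)) := ht ▸ trivial
    have hle : Submodule.span ℝ (PointedCone.hull ℝ t : Set (Fin n → ℝ)) ≤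
        LinearMap.ker (dotProductEquiv ℝ (Fin n) u) := by
      refine Submodule.span_le.2 fun x hx => ?_
      have h1 := hull_nonneg_and_mem_face u (fun x hx => (hu x hx).ge) hx
      have h2 := hull_nonneg_and_mem_face (-u) (fun x hx => by
        rw [neg_dotProduct, hu x hx, neg_zero]) hx
      rw [neg_dotProduct] at h2
      change u ⬝ᵥ x = 0
      linarith [h1.1, h2.1]
    exact hle hv
  exact dotProduct_self_eq_zero.1 (h u)

/-- Each of the bounds that define the monomials of the ideal in a chart is attained. -/
lemma exists_weight_eq_and_forall_ge {ι : Type*} [Fintype ι] {ν : ι → Fin n → ℤ}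
    (hν : LinearIndependent ℝ fun i => toReal (ν i)) (w : ι → Fin n → ℤ) (i : ι) :
    ∃ p : Fin n → ℤ, p ⬝ᵥ ν i = -(w i ⬝ᵥ ν i) ∧ ∀ j, 0 ≤ p ⬝ᵥ ν j + w j ⬝ᵥ ν j := by
  obtain ⟨m, hm0, hm⟩ := exists_int_form_of_linearIndependent hν i
  let k : ℤ := ∑ j, |w i ⬝ᵥ ν j - w j ⬝ᵥ ν j|
  refine ⟨-w i + k • m, ?_, fun j => ?_⟩
  · rw [add_dotProduct, smul_dotProduct, hm0]
    simp
  · rw [add_dotProduct, smul_dotProduct, neg_dotProduct, smul_eq_mul]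
    by_cases hj : j = i
    · rw [hj, hm0]; simp
    · have h1 : |w i ⬝ᵥ ν j - w j ⬝ᵥ ν j| ≤ k :=
        Finset.single_le_sum (f := fun j => |w i ⬝ᵥ ν j - w j ⬝ᵥ ν j|)
          (fun _ _ => abs_nonneg _) (Finset.mem_univ j)
      have h2 := le_abs_self (w i ⬝ᵥ ν j - w j ⬝ᵥ ν j)
      have h3 := abs_nonneg (w i ⬝ᵥ ν j - w j ⬝ᵥ ν j)
      nlinarith [hm j hj]

end ToricHypersurface

namespace ToricFan

/-! ### Lattice vectors at torus fixed points -/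

open ToricHypersurface

variable {n : ℕ} {S : ToricFan n}

/-- If `Y` is Cartier at the torus fixed point of a full-dimensional cone, then the least weights of
`f` on the generators of the cone are the weights of one lattice vector. -/
lemma exists_lattice_vector_of_isCartierDivisor {f : Laurent n} (hf : f ≠ 0)
    (h : IsCartierDivisor (S.closureIdealSheaf f)) {σ : Cone n} (hS : σ ∈ S.cones)
    {ι : Type*} [Fintype ι] {ν w : ι → Fin n → ℤ}
    (hν : LinearIndependent ℝ fun i => toReal (ν i))
    (hσ : σ = PointedCone.hull ℝ (Set.range fun i => toReal (ν i)))
    (hfull : Submodule.span ℝ (σ : Set (Fin n → ℝ)) = ⊤)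
    (hw : ∀ i, w i ∈ f.coeff.support)
    (hmin : ∀ i, ∀ w' ∈ f.coeff.support, w i ⬝ᵥ ν i ≤ w' ⬝ᵥ ν i) :
    ∃ u : Fin n → ℤ, ∀ i, u ⬝ᵥ ν i = w i ⬝ᵥ ν i := by
  have hmul := forall_support_mul_mem_dualMonoid_iff hw hmin
  rw [← hσ] at hmul
  have hmem : ∀ m, m ∈ dualMonoid σ ↔ ∀ i, 0 ≤ m ⬝ᵥ ν i := by
    rw [hσ]; exact mem_dualMonoid_hull ν
  have hzero : ∀ m : Fin n → ℤ, (∀ i, m ⬝ᵥ ν i = 0) → m = 0 := by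
    intro m hm
    have h0 : toReal m = 0 := by
      refine eq_zero_of_forall_dotProduct_eq_zero (hσ ▸ hfull) ?_
      rintro _ ⟨i, rfl⟩
      simp [toReal_dotProduct_toReal, hm i]
    exact toReal_injective (h0.trans (by ext; simp [toReal]))
  let wt : (Fin n → ℤ) →+ ℤ :=
    { toFun := fun m => ∑ i, m ⬝ᵥ ν i
      map_zero' := by simp
      map_add' := fun a b => by simp [add_dotProduct, Finset.sum_add_distrib] }
  have hwt : ∀ m ∈ dualMonoid σ, 0 ≤ wt m := fun m hm =>
    Finset.sum_nonneg fun i _ => (hmem m).1 hm i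
  have hwt0 : ∀ m ∈ dualMonoid σ, wt m = 0 → m = 0 := fun m hm h0 =>
    hzero m fun i => (Finset.sum_eq_zero_iff_of_nonneg fun i _ => (hmem m).1 hm i).1 h0 i
      (Finset.mem_univ i)
  have hpointed : ∀ m ∈ dualMonoid σ, -m ∈ dualMonoid σ → m = 0 := fun m hm hm' =>
    hwt0 m hm (le_antisymm (by have := hwt _ hm'; rw [map_neg] at this; linarith) (hwt m hm))
  let p : PrimeSpectrum (chartRing σ) :=
    ⟨RingHom.ker (constantTerm σ hpointed), RingHom.ker_isPrime _⟩
  obtain ⟨j, hj, hgen⟩ := S.exists_local_generator h ⟨σ, hS⟩ p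
  obtain ⟨d, hd⟩ := Ideal.mem_span_singleton.1 hj
  let P : Set (Fin n → ℤ) := {m | ∀ i, 0 ≤ m ⬝ᵥ ν i + w i ⬝ᵥ ν i}
  have hP : P.Nonempty := by
    rcases isEmpty_or_nonempty ι with hι | ⟨⟨i⟩⟩
    · exact ⟨0, fun i => hι.elim i⟩
    · obtain ⟨q, -, hq⟩ := exists_weight_eq_and_forall_ge hν w i
      exact ⟨q, hq⟩
  have hdP : ∀ m ∈ d.coeff.support, m ∈ P :=
    (hmul d).1 (hd ▸ fun m hm => mem_dualMonoid_of_mem_support hm)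
  obtain ⟨b, hb, hbP⟩ := exists_monomial_generator (dualMonoid σ) wt hwt hwt0 hP hdP (by
    intro m hm
    obtain ⟨a, ha⟩ := exists_chartRingToLaurent_eq ((hmul (.single m 1)).2
      (forall_mem_support_single (P := fun m => m ∈ P) hm))
    obtain ⟨s, hs, c, hc⟩ := hgen a (by
      change chartRingToLaurent σ a ∈ _
      rw [ha]; exact Ideal.mem_span_singleton.2 ⟨_, rfl⟩)
    refine ⟨chartRingToLaurent σ s, chartRingToLaurent σ c,
      fun _ => mem_dualMonoid_of_mem_support, fun _ => mem_dualMonoid_of_mem_support, ?_, ?_⟩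
    · have := coeff_chartRingToLaurent σ s 0
      rw [ZeroMemClass.coe_zero] at this
      rw [this]
      exact fun h0 => hs h0
    · have h1 := congrArg (chartRingToLaurent σ) hc
      have hd' : chartRingToLaurent σ j = f * d := hd
      rw [map_mul, map_mul, ha, hd'] at h1
      refine mul_left_cancel₀ hf ?_
      linear_combination h1)
  refine ⟨-b, fun i => ?_⟩
  obtain ⟨q, hq, hqP⟩ := exists_weight_eq_and_forall_ge hν w i
  have h1 := (hmem _).1 (hbP q hqP) i
  have h2 := hb i
  rw [sub_dotProduct, hq] at h1
  rw [neg_dotProduct]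
  linarith

/-- The point of `C(Δ)` at which the forms in a cone of the fan are minimal takes on each ray
generator of the cone the minimum of that generator over `Δ`. -/
lemma IsMinimalFor.dotProduct_eq_minOn {Δ : Set (Fin n → ℝ)} (hS : S.IsMinimalFor Δ)
    {ν w : Fin n → ℤ} (hν : ν ∈ S.rayGenerators) {x : Fin n → ℝ} (hx : x ∈ canonicalClosure Δ)
    (hmin : ∀ y ∈ canonicalClosure Δ, x ⬝ᵥ toReal ν ≤ y ⬝ᵥ toReal ν)
    (hw : toReal w ∈ canonicalClosure Δ) (hwν : minOn Δ ν = ((w ⬝ᵥ ν : ℤ) : ℝ)) :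
    x ⬝ᵥ toReal ν = ((w ⬝ᵥ ν : ℤ) : ℝ) := by
  refine le_antisymm ?_ (hwν ▸ hx ν (hS.rays ▸ hν))
  rw [← toReal_dotProduct_toReal]
  exact hmin _ hw

end ToricFan

/-! ### Comparison with the canonical closure -/

open ToricHypersurface in
/-- Let `Δ` be a full-dimensional lattice polytope with `F(Δ) ≠ ∅` and `f` a Laurent polynomial with
Newton polytope `Δ`. The closure `Y` of `Z_f` in the toric variety `ℙ` is a Cartier divisor if and
only if `C(Δ)` is a lattice polytope. -/
theorem mainTheorem9 (n : ℕ) (Δ : Set (Fin n → ℝ)) (hΔ : IsLatticePolytope Δ)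
    (hdim : (interior Δ).Nonempty) (hF : (fineInterior Δ).Nonempty)
    (S : ToricFan n) (hS : S.IsMinimalFor Δ)
    (f : Laurent n) (hf : newtonPolytope f = Δ) :
    IsCartierDivisor (S.closureIdealSheaf f) ↔ IsLatticePolytope (canonicalClosure Δ) := by
  classical
  have hsupp : f.coeff.support.Nonempty := by
    rw [Finset.nonempty_iff_ne_empty]
    intro h0
    obtain ⟨x, hx⟩ := hdim.mono interior_subset
    rw [← hf, newtonPolytope, h0] at hx
    simp at hx
  have hf0 : f ≠ 0 := by
    rintro rfl
    simp at hsupp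
  have hminOn := fun ν => exists_minOn_convexHull hsupp ν
  change ∀ ν, ∃ w ∈ f.coeff.support, ToricHypersurface.minOn (newtonPolytope f) ν = _ ∧ _ ∧
    ∀ y ∈ newtonPolytope f, _ at hminOn
  rw [hf] at hminOn
  choose w hw hwmin hwle hΔw using hminOn
  have hwC : ∀ ν, toReal (w ν) ∈ canonicalClosure Δ := by
    intro ν ν' _
    rw [hwmin]
    refine hΔw ν' _ (hf ▸ subset_convexHull ℝ _ ⟨_, hw ν, rfl⟩)
  constructor
  · intro hC
    have hvertex : ∀ σ, σ ∈ S.cones → Submodule.span ℝ (σ : Set (Fin n → ℝ)) = ⊤ →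
        ∃ u : Fin n → ℤ, toReal u ∈ canonicalClosure Δ ∧
          ∀ v ∈ σ, ∀ y ∈ canonicalClosure Δ, toReal u ⬝ᵥ v ≤ y ⬝ᵥ v := by
      intro σ hσ hfull
      obtain ⟨x, hx, hxmin⟩ := hS.refines_canonicalClosure σ hσ
      obtain ⟨ι, _, ν, hν, hLI, hhull⟩ := hS.simplicial.exists_rayGenerators hσ
      obtain ⟨u, hu⟩ := S.exists_lattice_vector_of_isCartierDivisor hf0 hC hσ hLI hhull hfull
        (fun i => hw (ν i)) (fun i => hwle (ν i))
      have hux : toReal u = x := by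
        refine sub_eq_zero.1 (eq_zero_of_forall_dotProduct_eq_zero (hhull ▸ hfull) ?_)
        rintro _ ⟨i, rfl⟩
        have hνσ : toReal (ν i) ∈ σ := hhull ▸ PointedCone.subset_hull ⟨i, rfl⟩
        rw [sub_dotProduct, toReal_dotProduct_toReal, hu, hS.dotProduct_eq_minOn (hν i) hx
          (hxmin _ hνσ) (hwC (ν i)) (hwmin (ν i)), sub_self]
      exact ⟨u, hux ▸ hx, hux ▸ hxmin⟩
    choose! u huC humin using hvertex
    have hfin : {σ ∈ S.cones | Submodule.span ℝ (σ : Set (Fin n → ℝ)) = ⊤}.Finite :=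
      S.finite.subset fun _ h => h.1
    let K := hfin.toFinset.image u
    refine ⟨K, Set.Subset.antisymm (fun y hy => ?_) (convexHull_min ?_ ?_)⟩
    · by_contra hyK
      have hclosed : IsClosed (convexHull ℝ (toReal '' (K : Set (Fin n → ℤ)))) :=
        (K.finite_toSet.image _).isClosed_convexHull ℝ
      obtain ⟨l, c, hlc, hl⟩ :=
        geometric_hahn_banach_point_closed (convex_convexHull ℝ _) hclosed hyK
      obtain ⟨v₀, hv₀⟩ := (dotProductEquiv ℝ (Fin n)).surjective l.toLinearMap
      have hv₀' : ∀ z, l z = z ⬝ᵥ v₀ := fun z => by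
        rw [dotProduct_comm]
        exact (LinearMap.congr_fun hv₀ z).symm
      -- the forms separating `y` from the candidate vertices form an open set
      let O : Set (Fin n → ℝ) := ⋂ k ∈ K, {v | y ⬝ᵥ v < toReal k ⬝ᵥ v}
      have hO : IsOpen O := isOpen_biInter_finset fun k _ =>
        isOpen_lt (by fun_prop) (by fun_prop)
      have hv₀O : v₀ ∈ O := Set.mem_iInter₂.2 fun k hk => by
        have := hl _ (subset_convexHull ℝ _ ⟨k, hk, rfl⟩)
        rw [hv₀'] at hlc this
        exact hlc.trans this
      obtain ⟨σ, hσ, hfull, v, hvσ, hvO⟩ := hS.complete.exists_mem_fullDimensional hO ⟨v₀, hv₀O⟩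
      have huK : u σ ∈ K := Finset.mem_image_of_mem _ (hfin.mem_toFinset.2 ⟨hσ, hfull⟩)
      exact absurd (humin σ hσ hfull v hvσ y hy) (not_le.2 (Set.mem_iInter₂.1 hvO _ huK))
    · rintro _ ⟨k, hk, rfl⟩
      obtain ⟨σ, hσ, rfl⟩ := Finset.mem_image.1 hk
      obtain ⟨hσ, hfull⟩ := hfin.mem_toFinset.1 hσ
      exact huC σ hσ hfull
    · have : canonicalClosure Δ = ⋂ ν ∈ fineSupport Δ, {x | minOn Δ ν ≤ x ⬝ᵥ toReal ν} := by
        ext x; simp [canonicalClosure]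
      rw [this]
      exact convex_iInter₂ fun ν _ =>
        convex_halfSpace_ge ⟨fun _ _ => add_dotProduct _ _ _, fun _ _ => smul_dotProduct _ _ _⟩ _
  · rintro ⟨K, hK⟩
    refine S.isCartierDivisor_of_forall_chart fun ⟨σ, hσ⟩ => ?_
    obtain ⟨x, hx, hxmin⟩ := hS.refines_canonicalClosure σ hσ
    obtain ⟨ι, _, ν, hν, hLI, hhull⟩ := hS.simplicial.exists_rayGenerators hσ
    have hνσ : ∀ i, toReal (ν i) ∈ σ := fun i => hhull ▸ PointedCone.subset_hull ⟨i, rfl⟩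
    have hKne : K.Nonempty := by
      rw [Finset.nonempty_iff_ne_empty]
      rintro rfl
      rw [hK] at hx
      simp at hx
    -- a vertex that minimizes a form in the relative interior of the cone minimizes all its forms
    obtain ⟨u, hu, -, -, hule⟩ := exists_minOn_convexHull hKne (∑ i, ν i)
    rw [← hK] at hule
    have huC : toReal u ∈ canonicalClosure Δ := hK ▸ subset_convexHull ℝ _ ⟨u, hu, rfl⟩
    have hsum : ∀ z : Fin n → ℝ, z ⬝ᵥ toReal (∑ i, ν i) = ∑ i, z ⬝ᵥ toReal (ν i) := by
      intro z
      rw [← dotProduct_sum]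
      congr 1
      ext; simp [toReal]
    have hle : ∑ i, toReal u ⬝ᵥ toReal (ν i) ≤ ∑ i, x ⬝ᵥ toReal (ν i) := by
      rw [← hsum, ← hsum, toReal_dotProduct_toReal]
      exact hule x hx
    have hxu : ∀ i ∈ Finset.univ, x ⬝ᵥ toReal (ν i) = toReal u ⬝ᵥ toReal (ν i) :=
      (Finset.sum_eq_sum_iff_of_le fun i _ => hxmin _ (hνσ i) _ huC).1
        (le_antisymm (Finset.sum_le_sum fun i _ => hxmin _ (hνσ i) _ huC) hle)
    refine exists_chart_generator hf0 (fun i => hw (ν i)) (fun i => hwle (ν i)) hhull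
      (u := u) fun i => ?_
    have h1 := hS.dotProduct_eq_minOn (hν i) hx (hxmin _ (hνσ i)) (hwC (ν i)) (hwmin (ν i))
    rw [hxu i (Finset.mem_univ i), toReal_dotProduct_toReal] at h1
    exact_mod_cast h1
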